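/- A (finite) hypergraph $H=(V,E)$ consists of a finite vertex set $V$ and a set $E$ of subsets of $V$, called hyperedges. It is $K$-uniform if every hyperedge has exactly $K$ vertices, and simple if any two distinct hyperedges have at most one vertex in common. The degree of a vertex is the number of hyperedges containing it, and the maximum degree of $H$ is the largest degree of a vertex. A (proper) $q$-colouring of $H$ is a map $\sigma:V\to\{1,\dots,q\}$ under which no hyperedge is monochromatic, and $H$ is $q$-colourable if it has such a colouring. Let $q,K\ge 2$ be integers. Then, for every integer $\Delta>Kq^{K-1}\ln q+1$, there exist a $q$-colourable simple $K$-uniform hypergraph $H$ with maximum degree $\Delta$ and two distinct vertices $u,v$ of $H$ such that the degree of $u$ is $1$, the degree of $v$ is at most $\Delta$, and $\sigma(u)\neq\sigma(v)$ for every $q$-colouring $\sigma$ of $H$. -/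

import Mathlib

namespace Hypergraph

variable {V : Type*}

/-- Every hyperedge of `H` has exactly `K` vertices (used here for `K ≥ 2`). -/
def KUniform (H : Hypergraph V) (K : ℕ) : Prop :=
  ∀ e ∈ H.edgeSet, e.ncard = K

/-- `H` is simple (or linear): any two distinct hyperedges share at most one vertex. -/
def Simple (H : Hypergraph V) : Prop :=
  ∀ e ∈ H.edgeSet, ∀ f ∈ H.edgeSet, e ≠ f → (e ∩ f).encard ≤ 1

/-- The degree of a vertex is the number of hyperedges containing it (used here for finite `V`). -/
noncomputable def vertexDegree (H : Hypergraph V) (w : V) : ℕ :=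
  {e ∈ H.edgeSet | w ∈ e}.ncard

/-- The maximum of the vertex degrees of `H` is attained and equals `D`. -/
def HasMaxDegree (H : Hypergraph V) (D : ℕ) : Prop :=
  IsGreatest (H.vertexDegree '' H.vertexSet) D

/-- `σ` is a proper `q`-colouring of `H`: no hyperedge is monochromatic. -/
def ProperColouring (H : Hypergraph V) {q : ℕ} (σ : V → Fin q) : Prop :=
  ∀ e ∈ H.edgeSet, ∃ x ∈ e, ∃ y ∈ e, σ x ≠ σ y

/-- `H` has a proper `q`-colouring. -/
def QColourable (H : Hypergraph V) (q : ℕ) : Prop :=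
  ∃ σ : V → Fin q, H.ProperColouring σ

end Hypergraph

/-!
Take a set of `N + k` vertices and add hyperedges one at a time, keeping the family `K`-uniform,
linear and of maximum degree at most `Δ`. As long as at least `N` vertices have degree below `Δ`,
almost all `K`-tuples of them span an admissible new hyperedge, and by convexity each proper
colouring is constant on at least a proportion `q ^ (-(K - 1))` of all tuples. Averaging gives a
hyperedge that destroys a proportion `δ` of the remaining proper colourings, for any fixed
`δ < q ^ (-(K - 1))` once `N` is large. Exhausting all but `N` vertices takes at least `k * Δ / K`
hyperedges, so if `q ^ K * (1 - δ) ^ Δ < 1` and `k` is large, then the at most `q ^ (N + k)`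
colourings run out first.

In an edge-critical subfamily of the resulting non-colourable family, replace a vertex `x` of a
hyperedge `e` by a new vertex `u` of degree one. A proper colouring of the new family must be
constant on `e`, so the new hyperedge forces `u` to receive another colour than `x`. A disjoint star
with `Δ` hyperedges makes the maximum degree exactly `Δ`.
-/

open Finset

section Colouring

variable {V W C : Type*}

/-- The colouring `σ` is constant on the set `e`. -/
def IsMonochromatic (σ : V → C) (e : Finset V) : Prop :=
  ∀ x ∈ e, ∀ y ∈ e, σ x = σ y

/-- The colouring `σ` is proper for the set family `E`, seen as the hyperedges of a hypergraph: no
member of `E` is monochromatic. -/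
def IsProperColouring (E : Finset (Finset V)) (σ : V → C) : Prop :=
  ∀ e ∈ E, ¬ IsMonochromatic σ e

instance [DecidableEq C] (σ : V → C) (e : Finset V) : Decidable (IsMonochromatic σ e) :=
  inferInstanceAs (Decidable (∀ x ∈ e, ∀ y ∈ e, σ x = σ y))

instance [DecidableEq C] (E : Finset (Finset V)) (σ : V → C) : Decidable (IsProperColouring E σ) :=
  inferInstanceAs (Decidable (∀ e ∈ E, ¬ IsMonochromatic σ e))

lemma isMonochromatic_map {σ : W → C} {φ : V ↪ W} {e : Finset V} :
    IsMonochromatic σ (e.map φ) ↔ IsMonochromatic (σ ∘ φ) e := by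
  simp [IsMonochromatic]

lemma isProperColouring_insert [DecidableEq V] {E : Finset (Finset V)} {e : Finset V} {σ : V → C} :
    IsProperColouring (insert e E) σ ↔ ¬ IsMonochromatic σ e ∧ IsProperColouring E σ :=
  forall_mem_insert _ _ _

lemma isProperColouring_union [DecidableEq V] {E F : Finset (Finset V)} {σ : V → C} :
    IsProperColouring (E ∪ F) σ ↔ IsProperColouring E σ ∧ IsProperColouring F σ :=
  forall_mem_union

end Colouring

section LinearFamily

variable {V : Type*} [DecidableEq V]

/-- The family `E` is the set of hyperedges of a simple `K`-uniform hypergraph of maximum degree at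
most `D`. -/
structure IsLinearFamily (K D : ℕ) (E : Finset (Finset V)) : Prop where
  card_eq : ∀ e ∈ E, #e = K
  card_inter_le : ∀ e ∈ E, ∀ f ∈ E, e ≠ f → #(e ∩ f) ≤ 1
  degree_le : ∀ v, #{e ∈ E | v ∈ e} ≤ D

namespace IsLinearFamily

variable {K D : ℕ} {E F : Finset (Finset V)}

lemma empty : IsLinearFamily K D (∅ : Finset (Finset V)) :=
  ⟨by simp, by simp, by simp⟩

lemma mono (hE : IsLinearFamily K D E) (hFE : F ⊆ E) : IsLinearFamily K D F where
  card_eq e he := hE.card_eq e (hFE he)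
  card_inter_le e he f hf := hE.card_inter_le e (hFE he) f (hFE hf)
  degree_le v := (card_le_card (filter_subset_filter _ hFE)).trans (hE.degree_le v)

lemma insert (hE : IsLinearFamily K D E) {e : Finset V} (hcard : #e = K)
    (hinter : ∀ f ∈ E, #(e ∩ f) ≤ 1) (hdeg : ∀ v ∈ e, #{f ∈ E | v ∈ f} < D) :
    IsLinearFamily K D (insert e E) where
  card_eq := (forall_mem_insert _ _ _).2 ⟨hcard, hE.card_eq⟩
  card_inter_le f hf g hg hfg := by
    rcases mem_insert.1 hf with rfl | hf <;> rcases mem_insert.1 hg with rfl | hg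
    · exact absurd rfl hfg
    · exact hinter g hg
    · rw [inter_comm]
      exact hinter f ‹f ∈ E›
    · exact hE.card_inter_le f hf g hg hfg
  degree_le v := by
    rw [filter_insert]
    split_ifs with hv
    · exact (card_insert_le _ _).trans (hdeg v hv)
    · exact hE.degree_le v

lemma union_of_disjoint (hE : IsLinearFamily K D E) (hF : IsLinearFamily K D F)
    (hdisj : ∀ e ∈ E, ∀ f ∈ F, Disjoint e f) : IsLinearFamily K D (E ∪ F) where
  card_eq := forall_mem_union.2 ⟨hE.card_eq, hF.card_eq⟩
  card_inter_le e he f hf hef := by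
    rcases mem_union.1 he with he | he <;> rcases mem_union.1 hf with hf | hf
    · exact hE.card_inter_le e he f hf hef
    · simp [disjoint_iff_inter_eq_empty.1 (hdisj e he f hf)]
    · simp [disjoint_iff_inter_eq_empty.1 (hdisj f hf e he).symm]
    · exact hF.card_inter_le e he f hf hef
  degree_le v := by
    rw [filter_union]
    by_cases hv : ∃ e ∈ E, v ∈ e
    · obtain ⟨e, he, hve⟩ := hv
      have hFv : ({f ∈ F | v ∈ f} : Finset _) = ∅ :=
        filter_false_of_mem fun f hf => disjoint_left.1 (hdisj e he f hf) hve
      rw [hFv, union_empty]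
      exact hE.degree_le v
    · push Not at hv
      rw [filter_false_of_mem hv, empty_union]
      exact hF.degree_le v

end IsLinearFamily

end LinearFamily

section TupleCounting

variable {V C ι : Type*} [Fintype ι] [DecidableEq ι]

lemma card_tuples_related_at_le {B : ℕ} (A : Finset V) (R : V → V → Prop) [DecidableRel R]
    (hR : ∀ x, #{y ∈ A | R x y} ≤ B) {i j : ι} (hij : i ≠ j) :
    #{t ∈ Fintype.piFinset (fun _ : ι => A) | R (t i) (t j)} ≤
      B * #A ^ (Fintype.card ι - 1) := by
  have hcard : #(Fintype.piFinset (fun _ : {k : ι // k ≠ j} => A)) =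
      #A ^ (Fintype.card ι - 1) := by
    simp [Fintype.card_subtype_compl]
  classical
  rw [← hcard]
  -- Forgetting the entry at `j` is at most `B`-to-one, as that entry is related to the one at `i`.
  refine card_le_mul_card_image_of_maps_to
    (f := fun (t : ι → V) (k : {k : ι // k ≠ j}) => t k) (fun t ht => ?_) B fun b _ => ?_
  · exact Fintype.mem_piFinset.2 fun k => Fintype.mem_piFinset.1 (mem_filter.1 ht).1 k
  · refine le_trans (card_le_card_of_injOn (fun t => t j) ?_ ?_) (hR (b ⟨i, hij⟩))
    · intro t ht
      simp only [coe_filter, mem_filter, Fintype.mem_piFinset, Set.mem_ofPred_eq] at ht ⊢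
      obtain ⟨⟨ht, hr⟩, rfl⟩ := ht
      exact ⟨ht j, hr⟩
    · intro t ht s hs hts
      simp only [coe_filter, mem_filter, Set.mem_ofPred_eq] at ht hs
      funext k
      by_cases hk : k = j
      · exact hk ▸ hts
      · exact congrFun (ht.2.trans hs.2.symm) ⟨k, hk⟩

lemma card_tuples_exists_related_le {B : ℕ} (A : Finset V) (R : V → V → Prop) [DecidableRel R]
    (hR : ∀ x, #{y ∈ A | R x y} ≤ B) :
    #{t ∈ Fintype.piFinset (fun _ : ι => A) | ∃ i j, i ≠ j ∧ R (t i) (t j)} ≤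
      Fintype.card ι ^ 2 * (B * #A ^ (Fintype.card ι - 1)) := by
  classical
  have hsub : {t ∈ Fintype.piFinset (fun _ : ι => A) | ∃ i j, i ≠ j ∧ R (t i) (t j)} ⊆
      ({p : ι × ι | p.1 ≠ p.2} : Finset _).biUnion
        fun p => {t ∈ Fintype.piFinset (fun _ : ι => A) | R (t p.1) (t p.2)} := by
    intro t
    simp only [mem_filter, mem_biUnion, mem_univ, true_and, Prod.exists]
    rintro ⟨ht, i, j, hij, hr⟩
    exact ⟨i, j, hij, ht, hr⟩
  have hpairs : #({p : ι × ι | p.1 ≠ p.2} : Finset _) ≤ Fintype.card ι ^ 2 :=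
    (card_filter_le _ _).trans (by simp [sq])
  calc _ ≤ _ := card_le_card hsub
    _ ≤ #({p : ι × ι | p.1 ≠ p.2} : Finset _) * (B * #A ^ (Fintype.card ι - 1)) :=
      card_biUnion_le_card_mul _ _ _ fun p hp =>
        card_tuples_related_at_le A R hR (mem_filter.1 hp).2
    _ ≤ _ := Nat.mul_le_mul_right _ hpairs

lemma card_pow_le_mul_card_constant_tuples [Nonempty ι] [Fintype C] [DecidableEq C]
    (A : Finset V) (σ : V → C) :
    #A ^ Fintype.card ι ≤ Fintype.card C ^ (Fintype.card ι - 1) *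
      #{t ∈ Fintype.piFinset (fun _ : ι => A) | ∀ i j, σ (t i) = σ (t j)} := by
  obtain ⟨i₀⟩ := ‹Nonempty ι›
  have hpow : #A ^ Fintype.card ι ≤ Fintype.card C ^ (Fintype.card ι - 1) *
      ∑ c : C, #{v ∈ A | σ v = c} ^ Fintype.card ι := by
    rw [card_eq_sum_card_fiberwise (f := σ) (t := univ) fun _ _ => mem_coe.2 (mem_univ _),
      ← Nat.sub_add_cancel (Fintype.card_pos_iff.2 ⟨i₀⟩)]
    exact pow_sum_le_card_mul_sum_pow (fun _ _ => Nat.zero_le _) _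
  refine hpow.trans (Nat.mul_le_mul_left _ ?_)
  rw [card_eq_sum_card_fiberwise (f := fun t : ι → V => σ (t i₀)) (t := univ)
    fun _ _ => mem_coe.2 (mem_univ _)]
  refine sum_le_sum fun c _ => ?_
  rw [← card_univ, ← prod_const, ← Fintype.card_piFinset]
  refine card_le_card fun t ht => ?_
  simp only [Fintype.mem_piFinset, mem_filter] at ht ⊢
  exact ⟨⟨fun i => (ht i).1, fun i j => (ht i).2.trans (ht j).2.symm⟩, (ht i₀).2⟩

lemma mul_card_le_card_unrelated_constant_tuples [Nonempty ι] [Nonempty C] [Fintype C]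
    [DecidableEq C] {B : ℕ} (A : Finset V) (R : V → V → Prop) [DecidableRel R]
    (hR : ∀ x, #{y ∈ A | R x y} ≤ B) {δ : ℝ}
    (hA : (Fintype.card ι ^ 2 * B : ℝ) ≤
      #A * (((Fintype.card C : ℝ) ^ (Fintype.card ι - 1))⁻¹ - δ)) (σ : V → C) :
    δ * #(Fintype.piFinset fun _ : ι => A) ≤
      #{t ∈ Fintype.piFinset (fun _ : ι => A) |
        (∀ i j, i ≠ j → ¬ R (t i) (t j)) ∧ ∀ i j, σ (t i) = σ (t j)} := by
  set T := Fintype.piFinset fun _ : ι => A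
  have hT : (#T : ℝ) = #A * (#A : ℝ) ^ (Fintype.card ι - 1) := by
    rw [mul_pow_sub_one Fintype.card_ne_zero]
    simp [T]
  have hconst : ((Fintype.card C : ℝ) ^ (Fintype.card ι - 1))⁻¹ * #T ≤
      #{t ∈ T | ∀ i j, σ (t i) = σ (t j)} := by
    rw [inv_mul_le_iff₀ (by positivity)]
    simpa [T] using mod_cast card_pow_le_mul_card_constant_tuples (ι := ι) A σ
  have hrel : (#{t ∈ T | ∃ i j, i ≠ j ∧ R (t i) (t j)} : ℝ) ≤
      Fintype.card ι ^ 2 * B * (#A : ℝ) ^ (Fintype.card ι - 1) := by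
    rw [mul_assoc]
    exact_mod_cast card_tuples_exists_related_le A R hR
  have hsplit : (#{t ∈ T | ∀ i j, σ (t i) = σ (t j)} : ℝ) ≤
      #{t ∈ T | ∃ i j, i ≠ j ∧ R (t i) (t j)} +
      #{t ∈ T | (∀ i j, i ≠ j → ¬ R (t i) (t j)) ∧ ∀ i j, σ (t i) = σ (t j)} := by
    classical
    refine mod_cast (card_le_card fun t ht => ?_).trans (card_union_le _ _)
    simp only [mem_union, mem_filter] at ht ⊢
    by_cases h : ∃ i j, i ≠ j ∧ R (t i) (t j)
    · exact .inl ⟨ht.1, h⟩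
    · push Not at h
      exact .inr ⟨ht.1, h, ht.2⟩
  have hloss : (Fintype.card ι ^ 2 * B * (#A : ℝ) ^ (Fintype.card ι - 1) : ℝ) ≤
      (((Fintype.card C : ℝ) ^ (Fintype.card ι - 1))⁻¹ - δ) * #T := by
    rw [hT, ← mul_assoc, mul_comm _ (#A : ℝ)]
    gcongr
  rw [sub_mul] at hloss
  linarith

end TupleCounting

lemma exists_mul_card_le_card_filter {α β : Type*} {S : Finset α} {T : Finset β}
    (hT : T.Nonempty) (r : α → β → Prop) [∀ a b, Decidable (r a b)] {δ : ℝ}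
    (h : ∀ a ∈ S, δ * #T ≤ #{b ∈ T | r a b}) :
    ∃ b ∈ T, δ * #S ≤ #{a ∈ S | r a b} := by
  refine exists_le_of_sum_le hT ?_
  calc ∑ _b ∈ T, δ * (#S : ℝ) = ∑ _a ∈ S, δ * (#T : ℝ) := by
        simp only [sum_const, nsmul_eq_mul]
        ring
    _ ≤ ∑ a ∈ S, (#{b ∈ T | r a b} : ℝ) := sum_le_sum h
    _ = ∑ b ∈ T, (#{a ∈ S | r a b} : ℝ) :=
      mod_cast sum_card_bipartiteAbove_eq_sum_card_bipartiteBelow r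

section Greedy

variable {V C : Type*} [DecidableEq V]

/-- Two vertices conflict in the family `E` if they cannot both be entries of a tuple of distinct
vertices that spans a new hyperedge meeting every member of `E` at most once. -/
def Conflict (E : Finset (Finset V)) (x y : V) : Prop :=
  x = y ∨ ∃ f ∈ E, x ∈ f ∧ y ∈ f

instance (E : Finset (Finset V)) : DecidableRel (Conflict E) := fun x y =>
  inferInstanceAs (Decidable (x = y ∨ ∃ f ∈ E, x ∈ f ∧ y ∈ f))

/-- The vertices in fewer than `D` members of `E`, which may still be used in a new hyperedge. -/
def unsaturated [Fintype V] (D : ℕ) (E : Finset (Finset V)) : Finset V :=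
  {v | #{e ∈ E | v ∈ e} < D}

lemma card_image_eq_and_card_inter_le_one {ι : Type*} [Fintype ι] {E : Finset (Finset V)}
    {t : ι → V} (ht : ∀ i j, i ≠ j → ¬ Conflict E (t i) (t j)) :
    #(univ.image t) = Fintype.card ι ∧ ∀ f ∈ E, #(univ.image t ∩ f) ≤ 1 := by
  constructor
  · refine card_image_of_injective _ fun i j hij => ?_
    by_contra hne
    exact ht i j hne (.inl hij)
  · intro f hf
    simp only [card_le_one, mem_inter, mem_image, mem_univ, true_and]
    rintro _ ⟨⟨i, rfl⟩, hi⟩ _ ⟨⟨j, rfl⟩, hj⟩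
    by_contra hne
    exact ht i j (ne_of_apply_ne t hne) (.inr ⟨f, hf, hi, hj⟩)

namespace IsLinearFamily

variable {K D : ℕ} {E : Finset (Finset V)}

lemma card_conflict_le (hE : IsLinearFamily K D E) (A : Finset V) (x : V) :
    #{y ∈ A | Conflict E x y} ≤ K * D + 1 := by
  have hsub : {y ∈ A | Conflict E x y} ⊆ Insert.insert x ({f ∈ E | x ∈ f}.biUnion id) := by
    intro y hxy
    obtain ⟨-, rfl | ⟨f, hf, hx, hy⟩⟩ := mem_filter.1 hxy
    · exact mem_insert_self _ _
    · exact mem_insert_of_mem (mem_biUnion.2 ⟨f, mem_filter.2 ⟨hf, hx⟩, hy⟩)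
  calc _ ≤ _ := card_le_card hsub
    _ ≤ #({f ∈ E | x ∈ f}.biUnion id) + 1 := card_insert_le _ _
    _ ≤ #{f ∈ E | x ∈ f} * K + 1 := by
      gcongr
      exact card_biUnion_le_card_mul _ _ _ fun f hf => (hE.card_eq f (mem_filter.1 hf).1).le
    _ ≤ K * D + 1 := by
      rw [mul_comm K]
      gcongr
      exact hE.degree_le x

lemma exists_new_hyperedge [Fintype C] [DecidableEq C] [Nonempty C] (hE : IsLinearFamily K D E)
    (hK : K ≠ 0) {A : Finset V} {S : Finset (V → C)} (hS : S.Nonempty) {δ : ℝ} (hδ : 0 < δ)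
    (hA : (K ^ 2 * (K * D + 1 : ℕ) : ℝ) ≤ #A * (((Fintype.card C : ℝ) ^ (K - 1))⁻¹ - δ)) :
    ∃ e ⊆ A, #e = K ∧ (∀ f ∈ E, #(e ∩ f) ≤ 1) ∧ δ * #S ≤ #{σ ∈ S | IsMonochromatic σ e} := by
  have : NeZero K := ⟨hK⟩
  have hAne : A.Nonempty := by
    by_contra! hA0
    have : (0 : ℝ) < K ^ 2 * (K * D + 1 : ℕ) := by positivity
    simp only [hA0, card_empty, Nat.cast_zero, zero_mul] at hA
    exact absurd hA this.not_ge
  obtain ⟨t, htA, ht⟩ := exists_mul_card_le_card_filter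
    (Fintype.piFinset_nonempty.2 fun _ : Fin K => hAne)
    (fun (σ : V → C) t =>
      (∀ i j, i ≠ j → ¬ Conflict E (t i) (t j)) ∧ ∀ i j, σ (t i) = σ (t j))
    fun σ (_ : σ ∈ S) => by
      convert mul_card_le_card_unrelated_constant_tuples (ι := Fin K) A (Conflict E)
        (hE.card_conflict_le A) (by simpa only [Fintype.card_fin] using hA) σ
  have hconflict : ∀ i j, i ≠ j → ¬ Conflict E (t i) (t j) := by
    have hpos : (0 : ℝ) < δ * #S := by have := hS.card_pos; positivity
    obtain ⟨σ, hσ⟩ := card_pos.1 (Nat.cast_pos.1 (hpos.trans_le ht))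
    exact (mem_filter.1 hσ).2.1
  obtain ⟨hcard, hinter⟩ := card_image_eq_and_card_inter_le_one hconflict
  refine ⟨univ.image t, ?_, hcard.trans (Fintype.card_fin K), hinter, ht.trans ?_⟩
  · exact image_subset_iff.2 fun i _ => Fintype.mem_piFinset.1 htA i
  · refine mod_cast card_le_card fun σ hσ => ?_
    simp only [mem_filter] at hσ ⊢
    refine ⟨hσ.1, ?_⟩
    simpa [IsMonochromatic] using hσ.2.2

variable [Fintype V]

lemma card_compl_unsaturated_mul_le (hE : IsLinearFamily K D E) :
    #(unsaturated D E)ᶜ * D ≤ #E * K :=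
  calc #(unsaturated D E)ᶜ * D ≤ ∑ e ∈ E, #((unsaturated D E)ᶜ ∩ e) :=
        le_sum_card_inter fun v hv => by simpa [unsaturated] using hv
    _ ≤ #E • K := sum_le_card_nsmul _ _ _ fun e he =>
        (card_le_card inter_subset_right).trans (hE.card_eq e he).le

lemma le_card_unsaturated (hE : IsLinearFamily K D E) {N k : ℕ} (hV : Fintype.card V = N + k)
    {q r : ℝ} (hq : 0 ≤ q) (hr0 : 0 ≤ r) (hr1 : r ≤ 1)
    (hsmall : (q ^ K * r ^ D) ^ k * q ^ (K * N) < 1) (hE1 : 1 ≤ q ^ (N + k) * r ^ #E) :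
    N ≤ #(unsaturated D E) := by
  by_contra! hlt
  have hk : k ≤ #(unsaturated D E)ᶜ := by
    rw [card_compl, hV]
    omega
  have hEk : D * k ≤ #E * K :=
    (mul_comm D k).trans_le ((Nat.mul_le_mul_right D hk).trans hE.card_compl_unsaturated_mul_le)
  refine hsmall.not_ge ?_
  calc 1 ≤ (q ^ (N + k) * r ^ #E) ^ K := one_le_pow₀ hE1
    _ = q ^ (K * (N + k)) * r ^ (#E * K) := by rw [mul_pow, ← pow_mul, ← pow_mul, mul_comm K]
    _ ≤ q ^ (K * (N + k)) * r ^ (D * k) := by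
      gcongr q ^ (K * (N + k)) * ?_
      exact pow_le_pow_of_le_one hr0 hr1 hEk
    _ = (q ^ K * r ^ D) ^ k * q ^ (K * N) := by ring

variable [Fintype C] [DecidableEq C]

lemma exists_insert_card_properColourings_le [Nonempty C] (hE : IsLinearFamily K D E) (hK : 2 ≤ K)
    (hcol : ∃ σ : V → C, IsProperColouring E σ) {δ : ℝ} (hδ : 0 < δ)
    (hA : (K ^ 2 * (K * D + 1 : ℕ) : ℝ) ≤
      #(unsaturated D E) * (((Fintype.card C : ℝ) ^ (K - 1))⁻¹ - δ)) :
    ∃ e ∉ E, IsLinearFamily K D (Insert.insert e E) ∧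
      (#{σ : V → C | IsProperColouring (Insert.insert e E) σ} : ℝ) ≤
        (1 - δ) * #{σ : V → C | IsProperColouring E σ} := by
  obtain ⟨σ, hσ⟩ := hcol
  obtain ⟨e, heA, hcard, hinter, hmono⟩ := hE.exists_new_hyperedge (by omega)
    (S := ({σ | IsProperColouring E σ} : Finset (V → C))) ⟨σ, by simpa using hσ⟩ hδ hA
  refine ⟨e, fun he => ?_, hE.insert hcard hinter fun v hv => ?_, ?_⟩
  · have := hinter e he
    rw [inter_self] at this
    omega
  · simpa [unsaturated] using heA hv
  · have hsplit := card_filter_add_card_filter_not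
      (s := ({σ | IsProperColouring E σ} : Finset (V → C))) (IsMonochromatic · e)
    rw [← @Nat.cast_inj ℝ, Nat.cast_add] at hsplit
    simp only [isProperColouring_insert, filter_filter, and_comm] at hsplit hmono ⊢
    linarith

end IsLinearFamily

lemma exists_lt_mul_one_sub_pow_lt_one {a p : ℝ} (hp : 0 < p) {n : ℕ}
    (h : a * (1 - p) ^ n < 1) : ∃ δ, 0 < δ ∧ δ < p ∧ a * (1 - δ) ^ n < 1 := by
  have hcont : Continuous fun δ : ℝ => a * (1 - δ) ^ n := by fun_prop
  have hsmall := (hcont.tendsto p).eventually_lt_const h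
  obtain ⟨δ, hδ, hδ0, hδp⟩ :=
    ((hsmall.filter_mono nhdsWithin_le_nhds).and (Ioo_mem_nhdsLT hp)).exists
  exact ⟨δ, hδ0, hδp, hδ⟩

theorem exists_isLinearFamily_forall_not_isProperColouring [Fintype C] [Nonempty C] {K D : ℕ}
    (hK : 2 ≤ K) (hD : (Fintype.card C : ℝ) ^ K *
      (1 - ((Fintype.card C : ℝ) ^ (K - 1))⁻¹) ^ D < 1) :
    ∃ (n : ℕ) (E : Finset (Finset (Fin n))), IsLinearFamily K D E ∧
      ∀ σ : Fin n → C, ¬ IsProperColouring E σ := by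
  classical
  set q : ℝ := (Fintype.card C : ℝ)
  have hq : 1 ≤ q := Nat.one_le_cast.2 Fintype.card_pos
  obtain ⟨δ, hδ0, hδq, hδ⟩ := exists_lt_mul_one_sub_pow_lt_one (by positivity) hD
  have hδ1 : δ ≤ 1 := hδq.le.trans (inv_le_one_of_one_le₀ (one_le_pow₀ hq))
  obtain ⟨N, hN⟩ := exists_nat_ge ((K ^ 2 * (K * D + 1 : ℕ) : ℝ) / ((q ^ (K - 1))⁻¹ - δ))
  rw [div_le_iff₀ (sub_pos.2 hδq)] at hN
  obtain ⟨k, hk⟩ := exists_pow_lt_of_lt_one (by positivity : 0 < (q ^ (K * N))⁻¹) hδ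
  rw [← one_div, lt_div_iff₀ (by positivity)] at hk
  -- A maximal family obeying the greedy bound on the number of proper colourings has none left.
  obtain ⟨E, ⟨hE, hbound⟩, hmax⟩ := Set.Finite.exists_maximal
    (s := {E : Finset (Finset (Fin (N + k))) | IsLinearFamily K D E ∧
      (#{σ : Fin (N + k) → C | IsProperColouring E σ} : ℝ) ≤ q ^ (N + k) * (1 - δ) ^ #E})
    (Set.toFinite _) ⟨∅, .empty, by simp [IsProperColouring, q]⟩
  refine ⟨N + k, E, hE, fun σ hσ => ?_⟩
  have hone : (1 : ℝ) ≤ #{τ : Fin (N + k) → C | IsProperColouring E τ} :=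
    mod_cast card_pos.2 ⟨σ, by simpa using hσ⟩
  have hNE : N ≤ #(unsaturated D E) :=
    hE.le_card_unsaturated (Fintype.card_fin _) (by positivity) (sub_nonneg.2 hδ1)
      (sub_le_self 1 hδ0.le) hk (hone.trans hbound)
  obtain ⟨e, heE, hE', hdrop⟩ := hE.exists_insert_card_properColourings_le hK ⟨σ, hσ⟩ hδ0
    (hN.trans (by gcongr))
  refine heE (hmax ⟨hE', hdrop.trans ?_⟩ (subset_insert e E) (mem_insert_self e E))
  rw [card_insert_of_notMem heE, pow_succ']
  calc (1 - δ) * _ ≤ (1 - δ) * (q ^ (N + k) * (1 - δ) ^ #E) :=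
        mul_le_mul_of_nonneg_left hbound (sub_nonneg.2 hδ1)
    _ = _ := mul_left_comm _ _ _

end Greedy

section FamilyOperations

variable {V W C : Type*} {E : Finset (Finset V)} {F : Finset (Finset W)}

/-- The family of images of the members of `E` under the embedding `φ`. -/
def mapFamily (φ : V ↪ W) (E : Finset (Finset V)) : Finset (Finset W) :=
  E.map (mapEmbedding φ).toEmbedding

lemma mem_mapFamily {φ : V ↪ W} {f : Finset W} : f ∈ mapFamily φ E ↔ ∃ e ∈ E, e.map φ = f := by
  simp [mapFamily]

lemma isProperColouring_mapFamily {φ : V ↪ W} {σ : W → C} :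
    IsProperColouring (mapFamily φ E) σ ↔ IsProperColouring E (σ ∘ φ) := by
  simp [IsProperColouring, mapFamily, isMonochromatic_map]

variable [DecidableEq W]

lemma filter_mem_mapFamily_eq_empty {φ : V ↪ W} {w : W} (hw : w ∉ Set.range φ)
    (E : Finset (Finset V)) : ({f ∈ mapFamily φ E | w ∈ f} : Finset _) = ∅ := by
  refine filter_false_of_mem fun f hf hwf => ?_
  obtain ⟨e, -, rfl⟩ := mem_mapFamily.1 hf
  obtain ⟨v, -, rfl⟩ := mem_map.1 hwf
  exact hw ⟨v, rfl⟩

variable [DecidableEq V]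

/-- The disjoint union of two families, as the hyperedges of a disjoint union of hypergraphs. -/
def sumFamily (E : Finset (Finset V)) (F : Finset (Finset W)) : Finset (Finset (V ⊕ W)) :=
  mapFamily .inl E ∪ mapFamily .inr F

variable {K D : ℕ}

lemma card_filter_mem_mapFamily (φ : V ↪ W) (E : Finset (Finset V)) (v : V) :
    #{f ∈ mapFamily φ E | φ v ∈ f} = #{e ∈ E | v ∈ e} := by
  simp [mapFamily, filter_map, Function.comp_def]

lemma IsLinearFamily.mapFamily (hE : IsLinearFamily K D E) (φ : V ↪ W) :
    IsLinearFamily K D (mapFamily φ E) where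
  card_eq f hf := by
    obtain ⟨e, he, rfl⟩ := mem_mapFamily.1 hf
    rw [card_map, hE.card_eq e he]
  card_inter_le f hf g hg hfg := by
    obtain ⟨e, he, rfl⟩ := mem_mapFamily.1 hf
    obtain ⟨e', he', rfl⟩ := mem_mapFamily.1 hg
    rw [← map_inter, card_map]
    exact hE.card_inter_le e he e' he' (ne_of_apply_ne _ hfg)
  degree_le w := by
    by_cases hw : w ∈ Set.range φ
    · obtain ⟨v, rfl⟩ := hw
      exact (card_filter_mem_mapFamily φ E v).trans_le (hE.degree_le v)
    · simp [filter_mem_mapFamily_eq_empty hw]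

lemma IsLinearFamily.sumFamily (hE : IsLinearFamily K D E) (hF : IsLinearFamily K D F) :
    IsLinearFamily K D (sumFamily E F) := by
  refine (hE.mapFamily .inl).union_of_disjoint (hF.mapFamily .inr) fun e he f hf => ?_
  obtain ⟨e, -, rfl⟩ := mem_mapFamily.1 he
  obtain ⟨f, -, rfl⟩ := mem_mapFamily.1 hf
  exact disjoint_map_inl_map_inr e f

lemma isProperColouring_sumFamily {σ : V ⊕ W → C} : IsProperColouring (sumFamily E F) σ ↔
    IsProperColouring E (σ ∘ .inl) ∧ IsProperColouring F (σ ∘ .inr) := by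
  rw [sumFamily, isProperColouring_union, isProperColouring_mapFamily, isProperColouring_mapFamily]
  rfl

lemma card_filter_inl_mem_sumFamily (E : Finset (Finset V)) (F : Finset (Finset W)) (v : V) :
    #{e ∈ sumFamily E F | .inl v ∈ e} = #{e ∈ E | v ∈ e} := by
  rw [sumFamily, filter_union, filter_mem_mapFamily_eq_empty (φ := .inr) (by simp), union_empty]
  exact card_filter_mem_mapFamily .inl E v

lemma card_filter_inr_mem_sumFamily (E : Finset (Finset V)) (F : Finset (Finset W)) (w : W) :
    #{e ∈ sumFamily E F | .inr w ∈ e} = #{f ∈ F | w ∈ f} := by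
  rw [sumFamily, filter_union, filter_mem_mapFamily_eq_empty (φ := .inl) (by simp), empty_union]
  exact card_filter_mem_mapFamily .inr F w

end FamilyOperations

section Star

variable {ι κ C : Type*} [Fintype ι] [Fintype κ] [DecidableEq ι] [DecidableEq κ]

/-- The star with one hyperedge for each `i : ι`, consisting of the centre `none` and the leaves
`some (i, j)` with `j : κ`. -/
def starFamily (ι κ : Type*) [Fintype ι] [Fintype κ] [DecidableEq ι] [DecidableEq κ] :
    Finset (Finset (Option (ι × κ))) :=
  univ.image fun i => insertNone ({i} ×ˢ univ)

lemma mem_starFamily {e : Finset (Option (ι × κ))} :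
    e ∈ starFamily ι κ ↔ ∃ i, insertNone ({i} ×ˢ univ) = e := by
  simp [starFamily]

lemma isLinearFamily_starFamily :
    IsLinearFamily (Fintype.card κ + 1) (Fintype.card ι) (starFamily ι κ) where
  card_eq e he := by
    obtain ⟨i, rfl⟩ := mem_starFamily.1 he
    simp
  card_inter_le e he f hf hef := by
    obtain ⟨i, rfl⟩ := mem_starFamily.1 he
    obtain ⟨j, rfl⟩ := mem_starFamily.1 hf
    have hij : i ≠ j := fun h => hef (h ▸ rfl)
    rw [card_le_one_iff_subset_singleton]
    refine ⟨none, fun w hw => ?_⟩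
    cases w with
    | none => exact mem_singleton_self _
    | some w =>
      simp only [mem_inter, some_mem_insertNone, mem_product, mem_singleton, mem_univ,
        and_true] at hw
      exact absurd (hw.1.symm.trans hw.2) hij
  degree_le w := (card_filter_le _ _).trans card_image_le

lemma card_filter_none_mem_starFamily [Nonempty κ] :
    #{e ∈ starFamily ι κ | none ∈ e} = Fintype.card ι := by
  have hall : ∀ e ∈ starFamily ι κ, none ∈ e := fun e he => by
    obtain ⟨i, rfl⟩ := mem_starFamily.1 he
    exact none_mem_insertNone
  rw [filter_true_of_mem hall, starFamily, card_image_of_injective, card_univ]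
  intro i j hij
  obtain ⟨a⟩ := ‹Nonempty κ›
  have hmem := congrArg (some (i, a) ∈ ·) hij
  simpa [eq_comm] using hmem

lemma exists_isProperColouring_starFamily [Nonempty κ] [Nontrivial C] :
    ∃ σ : Option (ι × κ) → C, IsProperColouring (starFamily ι κ) σ := by
  obtain ⟨a, b, hab⟩ := exists_pair_ne C
  refine ⟨fun w => w.elim a fun _ => b, fun e he hmono => hab ?_⟩
  obtain ⟨i, rfl⟩ := mem_starFamily.1 he
  obtain ⟨j⟩ := ‹Nonempty κ›
  exact hmono none (by simp) (some (i, j)) (by simp)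

end Star

section Gadget

variable {V C : Type*} [DecidableEq V] {K D : ℕ} {E : Finset (Finset V)} {e : Finset V} {x : V}

/-- The family obtained from `E` by replacing the vertex `x` of its member `e` by the new vertex
`none`. -/
def detach (E : Finset (Finset V)) (e : Finset V) (x : V) : Finset (Finset (Option V)) :=
  insert (insertNone (e.erase x)) (mapFamily .some (E.erase e))

lemma isLinearFamily_detach (hE : IsLinearFamily K D E) (he : e ∈ E) (hx : x ∈ e) :
    IsLinearFamily K D (detach E e x) := by
  have hdeg : ∀ v ∈ e, #{f ∈ E.erase e | v ∈ f} < D := fun v hv => by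
    rw [filter_erase]
    exact (card_erase_lt_of_mem (mem_filter.2 ⟨he, hv⟩)).trans_le (hE.degree_le v)
  refine ((hE.mono (erase_subset e E)).mapFamily .some).insert ?_ ?_ ?_
  · rw [card_insertNone, card_erase_add_one hx, hE.card_eq e he]
  · intro f' hf'
    obtain ⟨f, hf, rfl⟩ := mem_mapFamily.1 hf'
    obtain ⟨hfe, hfE⟩ := mem_erase.1 hf
    have hsub : insertNone (e.erase x) ∩ f.map .some ⊆ (e ∩ f).map .some := by
      intro w hw
      cases w <;> simp_all
    calc _ ≤ _ := card_le_card hsub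
      _ = #(e ∩ f) := card_map _
      _ ≤ 1 := hE.card_inter_le e he f hfE hfe.symm
  · intro w hw
    cases w with
    | none =>
      rw [filter_mem_mapFamily_eq_empty (by simp), card_empty]
      exact (Nat.zero_le _).trans_lt (hdeg x hx)
    | some v =>
      exact (card_filter_mem_mapFamily .some _ v).trans_lt
        (hdeg v (mem_of_mem_erase (some_mem_insertNone.1 hw)))

lemma card_filter_none_mem_detach (E : Finset (Finset V)) (e : Finset V) (x : V) :
    #{f ∈ detach E e x | none ∈ f} = 1 := by
  rw [detach, filter_insert, if_pos none_mem_insertNone,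
    filter_mem_mapFamily_eq_empty (by simp), insert_empty_eq, card_singleton]

lemma isProperColouring_detach {σ : Option V → C} : IsProperColouring (detach E e x) σ ↔
    ¬ IsMonochromatic σ (insertNone (e.erase x)) ∧ IsProperColouring (E.erase e) (σ ∘ some) := by
  rw [detach, isProperColouring_insert, isProperColouring_mapFamily]
  rfl

lemma exists_isProperColouring_detach [Nontrivial C] (he : 2 ≤ #e)
    (hcol : ∃ σ : V → C, IsProperColouring (E.erase e) σ) :
    ∃ σ : Option V → C, IsProperColouring (detach E e x) σ := by
  obtain ⟨τ, hτ⟩ := hcol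
  obtain ⟨v, hv, hvx⟩ := exists_mem_ne he x
  obtain ⟨c, hc⟩ := exists_ne (τ v)
  refine ⟨fun w => w.elim c τ, isProperColouring_detach.2 ⟨fun hmono => hc ?_, hτ⟩⟩
  exact hmono none none_mem_insertNone (some v) (by simp [hv, hvx])

lemma ne_of_isProperColouring_detach (hE : ∀ σ : V → C, ¬ IsProperColouring E σ) (he : e ∈ E)
    {v : V} (hv : v ∈ e) {σ : Option V → C} (hσ : IsProperColouring (detach E e x) σ) :
    σ none ≠ σ (some v) := by
  intro heq
  obtain ⟨hnot, hrest⟩ := isProperColouring_detach.1 hσ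
  have hmono : IsMonochromatic (σ ∘ some) e := by
    by_contra hmono
    refine hE (σ ∘ some) ?_
    rw [← insert_erase he, isProperColouring_insert]
    exact ⟨hmono, hrest⟩
  have hconst : ∀ w ∈ insertNone (e.erase x), σ w = σ (some v) := by
    intro w hw
    cases w with
    | none => exact heq
    | some w => exact hmono w (mem_of_mem_erase (some_mem_insertNone.1 hw)) v hv
  exact hnot fun y hy z hz => (hconst y hy).trans (hconst z hz).symm

lemma exists_subset_critical (hE : ∀ σ : V → C, ¬ IsProperColouring E σ) :
    ∃ M ⊆ E, (∀ σ : V → C, ¬ IsProperColouring M σ) ∧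
      ∀ e ∈ M, ∃ σ : V → C, IsProperColouring (M.erase e) σ := by
  obtain ⟨M, hME, hM⟩ := exists_minimal_le_of_wellFoundedLT
    (fun M : Finset (Finset V) => ∀ σ : V → C, ¬ IsProperColouring M σ) E hE
  refine ⟨M, hME, hM.prop, fun e he => ?_⟩
  by_contra! hno
  exact notMem_erase e M (hM.le_of_le hno (erase_subset e M) he)

theorem IsLinearFamily.exists_separating [Nontrivial C] (hE : IsLinearFamily K D E) (hK : 2 ≤ K)
    (hcol : ∀ σ : V → C, ¬ IsProperColouring E σ) :
    ∃ F : Finset (Finset (Option V)), IsLinearFamily K D F ∧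
      (∃ σ : Option V → C, IsProperColouring F σ) ∧ #{e ∈ F | none ∈ e} = 1 ∧
      ∃ v : V, ∀ σ : Option V → C, IsProperColouring F σ → σ none ≠ σ (some v) := by
  obtain ⟨M, hME, hMcol, hMcrit⟩ := exists_subset_critical hcol
  have hM := hE.mono hME
  obtain ⟨c⟩ := Nontrivial.to_nonempty (α := C)
  obtain ⟨e, he⟩ : M.Nonempty := by
    by_contra! hempty
    exact hMcol (fun _ => c) (by simp [IsProperColouring, hempty])
  have hcard : 2 ≤ #e := hK.trans_eq (hM.card_eq e he).symm
  obtain ⟨x, hx⟩ : e.Nonempty := card_pos.1 (by omega)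
  exact ⟨detach M e x, isLinearFamily_detach hM he hx,
    exists_isProperColouring_detach hcard (hMcrit e he),
    card_filter_none_mem_detach M e x, x, fun σ => ne_of_isProperColouring_detach hMcol he hx⟩

end Gadget

section FamilyHypergraph

variable {V : Type*} {E : Finset (Finset V)}

/-- The hypergraph on all of `V` whose hyperedges are the members of `E`. -/
def familyHypergraph (E : Finset (Finset V)) : Hypergraph V where
  vertexSet := Set.univ
  edgeSet := (↑) '' (E : Set (Finset V))
  subset_vertexSet_of_mem_edgeSet' _ _ := Set.subset_univ _

lemma vertexDegree_familyHypergraph [DecidableEq V] (v : V) :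
    (familyHypergraph E).vertexDegree v = #{e ∈ E | v ∈ e} := by
  have hedges : {e ∈ (familyHypergraph E).edgeSet | v ∈ e} =
      (fun e : Finset V => (e : Set V)) '' ({e ∈ E | v ∈ e} : Finset _) := by
    ext s
    simp only [familyHypergraph, Set.mem_image, Set.mem_ofPred_eq, coe_filter, mem_coe]
    grind
  rw [Hypergraph.vertexDegree, hedges, Set.ncard_image_of_injective _ coe_injective,
    Set.ncard_coe_finset]

lemma properColouring_familyHypergraph {q : ℕ} {σ : V → Fin q} :
    (familyHypergraph E).ProperColouring σ ↔ IsProperColouring E σ := by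
  simp [Hypergraph.ProperColouring, familyHypergraph, IsProperColouring, IsMonochromatic]

namespace IsLinearFamily

variable [DecidableEq V] {K D : ℕ}

lemma kUniform (hE : IsLinearFamily K D E) : (familyHypergraph E).KUniform K := by
  rintro _ ⟨e, he, rfl⟩
  exact (Set.ncard_coe_finset e).trans (hE.card_eq e he)

lemma simple (hE : IsLinearFamily K D E) : (familyHypergraph E).Simple := by
  rintro _ ⟨e, he, rfl⟩ _ ⟨f, hf, rfl⟩ hef
  rw [← coe_inter, Set.encard_coe_eq_coe_finsetCard]
  exact_mod_cast hE.card_inter_le e he f hf (ne_of_apply_ne _ hef)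

lemma vertexDegree_le (hE : IsLinearFamily K D E) (v : V) :
    (familyHypergraph E).vertexDegree v ≤ D :=
  (vertexDegree_familyHypergraph v).trans_le (hE.degree_le v)

lemma hasMaxDegree (hE : IsLinearFamily K D E) {v : V} (hv : #{e ∈ E | v ∈ e} = D) :
    (familyHypergraph E).HasMaxDegree D :=
  ⟨⟨v, trivial, (vertexDegree_familyHypergraph v).trans hv⟩,
    Set.forall_mem_image.2 fun w _ => hE.vertexDegree_le w⟩

end IsLinearFamily

end FamilyHypergraph

lemma pow_mul_one_sub_pow_lt_one {x p : ℝ} (hx : 0 < x) (hp : p ≤ 1) {k n : ℕ}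
    (h : k * Real.log x < n * p) : x ^ k * (1 - p) ^ n < 1 :=
  calc x ^ k * (1 - p) ^ n ≤ Real.exp (Real.log x) ^ k * Real.exp (-p) ^ n := by
        rw [Real.exp_log hx]
        have := sub_nonneg.2 hp
        gcongr
        exact Real.one_sub_le_exp_neg p
    _ = Real.exp (k * Real.log x - n * p) := by
        rw [← Real.exp_nat_mul, ← Real.exp_nat_mul, ← Real.exp_add, mul_neg, sub_eq_add_neg]
    _ < 1 := Real.exp_lt_one_iff.2 (sub_neg.2 h)

lemma pow_mul_one_sub_inv_pow_lt_one {x : ℝ} (hx : 1 ≤ x) {k m n : ℕ}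
    (h : k * x ^ m * Real.log x < n) : x ^ k * (1 - (x ^ m)⁻¹) ^ n < 1 := by
  refine pow_mul_one_sub_pow_lt_one (by linarith) (inv_le_one_of_one_le₀ (one_le_pow₀ hx)) ?_
  rw [← div_eq_mul_inv, lt_div_iff₀ (by positivity), mul_right_comm]
  exact h

theorem mainTheorem8_general (q K : ℕ) (hq : 2 ≤ q) (hK : 2 ≤ K) (Δ : ℕ)
    (hΔ : (q : ℝ) ^ K * (1 - ((q : ℝ) ^ (K - 1))⁻¹) ^ Δ < 1) :
    ∃ (V : Type) (_ : Finite V) (H : Hypergraph V),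
      H.vertexSet = Set.univ ∧ H.KUniform K ∧ H.Simple ∧ H.HasMaxDegree Δ ∧ H.QColourable q ∧
      ∃ u v : V, u ≠ v ∧ H.vertexDegree u = 1 ∧ H.vertexDegree v ≤ Δ ∧
        ∀ σ : V → Fin q, H.ProperColouring σ → σ u ≠ σ v := by
  have : Nontrivial (Fin q) := Fin.nontrivial_iff_two_le.2 hq
  obtain ⟨n, E, hE, hcol⟩ := exists_isLinearFamily_forall_not_isProperColouring (C := Fin q) hK
    (by simpa only [Fintype.card_fin] using hΔ)
  obtain ⟨F, hF, ⟨τ, hτ⟩, hdeg, v, hsep⟩ := hE.exists_separating hK hcol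
  obtain ⟨k, rfl⟩ : ∃ k, K = k + 2 := ⟨K - 2, by omega⟩
  obtain ⟨ρ, hρ⟩ := exists_isProperColouring_starFamily
    (ι := Fin Δ) (κ := Fin (k + 1)) (C := Fin q)
  have hstar : IsLinearFamily (k + 2) Δ (starFamily (Fin Δ) (Fin (k + 1))) := by
    simpa using isLinearFamily_starFamily (ι := Fin Δ) (κ := Fin (k + 1))
  have hG := hF.sumFamily hstar
  refine ⟨_, inferInstance, familyHypergraph _, rfl, hG.kUniform, hG.simple,
    hG.hasMaxDegree (v := .inr none) ?_, ⟨Sum.elim τ ρ, ?_⟩, .inl none, .inl (some v), by simp, ?_,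
    hG.vertexDegree_le _, fun σ hσ => ?_⟩
  · rw [card_filter_inr_mem_sumFamily, card_filter_none_mem_starFamily, Fintype.card_fin]
  · exact properColouring_familyHypergraph.2 (isProperColouring_sumFamily.2 ⟨hτ, hρ⟩)
  · rw [vertexDegree_familyHypergraph, card_filter_inl_mem_sumFamily, hdeg]
  · exact hsep _ (isProperColouring_sumFamily.1 (properColouring_familyHypergraph.1 hσ)).1

theorem mainTheorem8 (q K : ℕ) (hq : 2 ≤ q) (hK : 2 ≤ K) (Δ : ℕ)
    (hΔ : (K : ℝ) * (q : ℝ) ^ (K - 1) * Real.log (q : ℝ) + 1 < (Δ : ℝ)) :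
    ∃ (V : Type) (_ : Finite V) (H : Hypergraph V),
      H.vertexSet = Set.univ ∧ H.KUniform K ∧ H.Simple ∧ H.HasMaxDegree Δ ∧ H.QColourable q ∧
      ∃ u v : V, u ≠ v ∧ H.vertexDegree u = 1 ∧ H.vertexDegree v ≤ Δ ∧
        ∀ σ : V → Fin q, H.ProperColouring σ → σ u ≠ σ v := by
  exact mainTheorem8_general q K hq hK Δ
    (pow_mul_one_sub_inv_pow_lt_one (mod_cast Nat.one_le_of_lt hq) (by linarith))
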